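/- Let $\|\cdot\|$ be an arbitrary norm on $\mathbb{R}^m$, let $\Xi\subseteq\mathbb{R}^m$ be convex and closed, let $N,K\ge 1$, let $\hat\xi_1,\dots,\hat\xi_N\in\Xi$, let $\varepsilon\ge 0$, and let $\ell_1,\dots,\ell_K:\mathbb{R}^m\to[-\infty,\infty]$ be such that each $-\ell_k$ is proper, convex and lower semicontinuous and no $\ell_k$ is identically $-\infty$ on $\Xi$. Put $\ell=\max_{k\le K}\ell_k$ and $\hat P_N=\frac1N\sum_{i=1}^N\delta_{\hat\xi_i}$. Let $\mathcal M(\Xi)$ be the set of probability distributions $Q$ supported on $\Xi$ with $\mathbb{E}^Q[\|\xi\|]<\infty$, let $$d_W(Q_1,Q_2)=\inf\Big\{\int\|\xi_1-\xi_2\|\,\Pi(d\xi_1,d\xi_2)\;:\;\Pi\text{ has marginals }Q_1,Q_2\Big\},$$ let $\mathbb{B}_\varepsilon(\hat P_N)=\{Q\in\mathcal M(\Xi): d_W(\hat P_N,Q)\le\varepsilon\}$, and consider the worst-case expectation $$\sup_{Q\in\mathbb{B}_\varepsilon(\hat P_N)}\mathbb{E}^Q[\ell(\xi)],\qquad(1)$$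 where $\mathbb{E}^Q[\ell]=\mathbb{E}^Q[\max\{\ell,0\}]+\mathbb{E}^Q[\min\{\ell,0\}]$ with $\infty-\infty=\infty$. Consider also the finite program $$\sup_{\alpha_{ik}\in\mathbb{R},\;q_{ik}\in\mathbb{R}^m}\ \frac1N\sum_{i=1}^N\sum_{k=1}^K\alpha_{ik}\,\ell_k\Big(\hat\xi_i-\frac{q_{ik}}{\alpha_{ik}}\Big)\qquad(2)$$ subject to $\frac1N\sum_{i,k}\|q_{ik}\|\le\varepsilon$, $\sum_{k}\alpha_{ik}=1$ for all $i$, and $\alpha_{ik}\ge0$, $\hat\xi_i-q_{ik}/\alpha_{ik}\in\Xi$ for all $i,k$. Here $0\cdot(-\infty)=0$ and $0/0=0$, and if $\alpha_{ik}=0\neq q_{ik}$, then the last constraint counts as violated. Suppose that $\Xi$ is compact or that $K=1$ (so that $\ell$ is concave). Then there are sequences $\{\alpha_{ik}(r),q_{ik}(r)\}_{r\in\mathbb{N}}$ of feasible decisions of (2) whose objective values converge (in $[-\infty,\infty]$) to the supremum of (2). For every such sequence, with $\xi_{ik}(r)=\hat\xi_i-q_{ik}(r)/\alpha_{ik}(r)$,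 the sequence $\{\alpha_{ik}(r),\xi_{ik}(r)\}_{r\in\mathbb{N}}$ has an accumulation point, and for each of its accumulation points $\{\alpha^\star_{ik},\xi^\star_{ik}\}$ the distribution $$Q^\star=\frac1N\sum_{i=1}^N\sum_{k=1}^K\alpha^\star_{ik}\,\delta_{\xi^\star_{ik}}$$ belongs to $\mathbb{B}_\varepsilon(\hat P_N)$ and attains the supremum in (1). -/

import Mathlib

noncomputable section

namespace WassersteinDRO

open MeasureTheory Filter Topology
open scoped ENNReal

variable {E : Type*} [NormedAddCommGroup E] [NormedSpace ℝ E]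

/-! ### Extended-real-valued convex functions -/

/-- A function is proper if it is below `+∞` at some point and never takes the value `-∞`. -/
def IsProper (f : E → EReal) : Prop :=
  (∃ x, f x < ⊤) ∧ ∀ x, ⊥ < f x

/-- An extended-real-valued function is convex if its epigraph is a convex set. -/
def IsConvexFun (f : E → EReal) : Prop :=
  Convex ℝ {p : E × ℝ | f p.1 ≤ (p.2 : EReal)}

/-- The convexity assumption: `Ξ` is convex and closed, every `-ℓ k` is proper, convex and lower
semicontinuous, and no `ℓ k` is identically `-∞` on `Ξ`. -/
structure ConvexityAssumption (Ξ : Set E) {K : ℕ} (ℓ : Fin K → E → EReal) : Prop where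
  convex_set : Convex ℝ Ξ
  closed_set : IsClosed Ξ
  proper : ∀ k, IsProper (fun x => -ℓ k x)
  convex : ∀ k, IsConvexFun (fun x => -ℓ k x)
  lsc : ∀ k, LowerSemicontinuous (fun x => -ℓ k x)
  not_bot : ∀ k, ∃ x ∈ Ξ, ℓ k x ≠ ⊥

/-- The loss `ℓ = max_k ℓ k`. -/
def loss {K : ℕ} (ℓ : Fin K → E → EReal) (x : E) : EReal := ⨆ k, ℓ k x

/-! ### Distributions, Wasserstein distance, worst-case expectation -/

section Measures

variable [MeasurableSpace E]

/-- The distributions supported on `Ξ` with finite first moment. -/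
def distributions (Ξ : Set E) : Set (Measure E) :=
  {Q | IsProbabilityMeasure Q ∧ Q Ξᶜ = 0 ∧ ∫⁻ x, ‖x‖ₑ ∂Q < ⊤}

/-- The joint distributions with marginals `Q₁` and `Q₂`. -/
def couplings (Q₁ Q₂ : Measure E) : Set (Measure (E × E)) :=
  {P | P.map Prod.fst = Q₁ ∧ P.map Prod.snd = Q₂}

/-- The (1-)Wasserstein distance with respect to the norm of `E`. -/
def wasserstein (Q₁ Q₂ : Measure E) : ℝ≥0∞ :=
  ⨅ P ∈ couplings Q₁ Q₂, ∫⁻ z, ‖z.1 - z.2‖ₑ ∂P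

/-- The uniform distribution on the `N` data points. -/
def empirical {N : ℕ} (data : Fin N → E) : Measure E :=
  (N : ℝ≥0∞)⁻¹ • ∑ i, Measure.dirac (data i)

/-- The Wasserstein ball of radius `ε` around the empirical distribution, within the
distributions on `Ξ`. -/
def ball (Ξ : Set E) {N : ℕ} (data : Fin N → E) (ε : ℝ) : Set (Measure E) :=
  {Q | Q ∈ distributions Ξ ∧ wasserstein (empirical data) Q ≤ ENNReal.ofReal ε}

open Classical in
/-- The expectation `E[max(f,0)] + E[min(f,0)]` in the extended reals, with the convention
`∞ - ∞ = ∞`. -/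
def expectation (Q : Measure E) (f : E → EReal) : EReal :=
  if ∫⁻ x, (f x).toENNReal ∂Q = ⊤ then ⊤
  else ((∫⁻ x, (f x).toENNReal ∂Q : ℝ≥0∞) : EReal) - ((∫⁻ x, (-f x).toENNReal ∂Q : ℝ≥0∞) : EReal)

/-- The worst-case expectation of the loss over the Wasserstein ball. -/
def worstCaseExpectation (Ξ : Set E) {N K : ℕ} (data : Fin N → E) (ε : ℝ)
    (ℓ : Fin K → E → EReal) : EReal :=
  ⨆ Q ∈ ball Ξ data ε, expectation Q (loss ℓ)

/-- The discrete distribution `(1/N) ∑ i, ∑ k, α i k • δ_(ξ i k)`. -/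
def discreteDistribution {N K : ℕ} (α : Fin N → Fin K → ℝ) (ξ : Fin N → Fin K → E) :
    Measure E :=
  (N : ℝ≥0∞)⁻¹ • ∑ i, ∑ k, ENNReal.ofReal (α i k) • Measure.dirac (ξ i k)

end Measures

/-! ### The finite convex program -/

/-- The atoms `ξ i k = data i - q i k / α i k`, with `0 / 0 = 0`. -/
def atoms {N K : ℕ} (data : Fin N → E) (α : Fin N → Fin K → ℝ) (q : Fin N → Fin K → E) :
    Fin N → Fin K → E :=
  fun i k => data i - (α i k)⁻¹ • q i k

/-- The feasible decisions `(α, q)`. If `α i k = 0` and `q i k ≠ 0`, then `q i k / α i k` has an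
infinite component and `data i - q i k / α i k` is not in `Ξ`: this is the condition `zero`. -/
structure Feasible (Ξ : Set E) {N K : ℕ} (data : Fin N → E) (ε : ℝ)
    (α : Fin N → Fin K → ℝ) (q : Fin N → Fin K → E) : Prop where
  budget : (1 / (N : ℝ)) * ∑ i, ∑ k, ‖q i k‖ ≤ ε
  sum_one : ∀ i, ∑ k, α i k = 1
  nonneg : ∀ i k, 0 ≤ α i k
  zero : ∀ i k, α i k = 0 → q i k = 0
  mem : ∀ i k, atoms data α q i k ∈ Ξ

/-- The objective `(1/N) ∑ i, ∑ k, α i k * ℓ k (data i - q i k / α i k)`, with `0 * (-∞) = 0`. -/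
def objective {N K : ℕ} (data : Fin N → E) (ℓ : Fin K → E → EReal)
    (α : Fin N → Fin K → ℝ) (q : Fin N → Fin K → E) : EReal :=
  ((1 / (N : ℝ) : ℝ) : EReal) * ∑ i, ∑ k, ((α i k : ℝ) : EReal) * ℓ k (atoms data α q i k)

/-- The optimal value of the finite convex program. -/
def optimalValue (Ξ : Set E) {N K : ℕ} (data : Fin N → E) (ε : ℝ)
    (ℓ : Fin K → E → EReal) : EReal :=
  sSup {v | ∃ α q, Feasible Ξ data ε α q ∧ objective data ℓ α q = v}

/-- A sequence of feasible decisions whose objective values converge to the optimal value. -/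
def IsMaximizing (Ξ : Set E) {N K : ℕ} (data : Fin N → E) (ε : ℝ) (ℓ : Fin K → E → EReal)
    (α : ℕ → Fin N → Fin K → ℝ) (q : ℕ → Fin N → Fin K → E) : Prop :=
  (∀ r, Feasible Ξ data ε (α r) (q r)) ∧
    Tendsto (fun r => objective data ℓ (α r) (q r)) atTop (𝓝 (optimalValue Ξ data ε ℓ))

end WassersteinDRO

end

/-!
In the variables `α` and `ξ` with `q i k = α i k • (data i - ξ i k)` the finite program maximizes an
upper semicontinuous function over a compact set: the weights lie in a simplex, and the atoms stay
bounded because `Ξ` is bounded or because `K = 1` forces every weight to be `1`. So every cluster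
point of a maximizing sequence is optimal. The discrete distribution of a feasible point lies in the
Wasserstein ball, and its expected loss is at least the objective value because `ℓ k ≤ loss ℓ`.

Conversely, let `Q` be in the ball and `ε' > ε`. A coupling of cost at most `ε'` splits into the
masses `μ i k` sent from `data i` to points where `loss ℓ` equals `ℓ k`. Replacing each `μ i k` by
its total mass placed at its mean keeps the cost at most `ε'` and, by Jensen's inequality, does not
decrease the expected loss. This gives feasible points of radius `ε'` whose value is at least the
expected loss under `Q`, and compactness passes to the limit `ε' → ε`. The positive part of `ℓ k` is
integrable, since a closed concave function without the value `∞` has an affine majorant.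
-/

namespace WassersteinDRO

open MeasureTheory Filter Topology
open scoped ENNReal

section Semicontinuity

variable {X : Type*} [TopologicalSpace X] {s : Set X}

lemma upperSemicontinuousOn_coe_mul {a : X → ℝ} {f : X → EReal} (ha : ContinuousOn a s)
    (ha₀ : ∀ x ∈ s, 0 ≤ a x) (hf : UpperSemicontinuousOn f s) (hf_top : ∀ x ∈ s, f x < ⊤) :
    UpperSemicontinuousOn (fun x => (a x : EReal) * f x) s := by
  intro x hx z hz
  obtain ⟨c, hfc, hcz⟩ : ∃ c : ℝ, f x < c ∧ ((a x * c : ℝ) : EReal) < z := by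
    rcases (ha₀ x hx).eq_or_lt with h0 | hpos
    · obtain ⟨c, hc, -⟩ := EReal.lt_iff_exists_real_btwn.1 (hf_top x hx)
      exact ⟨c, hc, by simpa [← h0] using hz⟩
    · have hpos' : (0 : EReal) < a x := EReal.coe_pos.2 hpos
      have hlt : f x < z / a x := by
        rwa [EReal.lt_div_iff hpos' (EReal.coe_ne_top _), mul_comm]
      obtain ⟨c, hc, hcz⟩ := EReal.lt_iff_exists_real_btwn.1 hlt
      rw [EReal.lt_div_iff hpos' (EReal.coe_ne_top _), mul_comm, ← EReal.coe_mul] at hcz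
      exact ⟨c, hc, hcz⟩
  have hac : ∀ᶠ y in 𝓝[s] x, ((a y * c : ℝ) : EReal) < z :=
    (continuous_coe_real_ereal.continuousAt.comp_continuousWithinAt
      ((ha x hx).mul_const c)).eventually_lt_const hcz
  filter_upwards [hac, hf x hx c hfc, self_mem_nhdsWithin] with y hy hfy hys
  calc (a y : EReal) * f y ≤ a y * c :=
        mul_le_mul_of_nonneg_left hfy.le (EReal.coe_nonneg.2 (ha₀ y hys))
    _ = ((a y * c : ℝ) : EReal) := (EReal.coe_mul _ _).symm
    _ < z := hy

lemma sum_lt_top {ι : Type*} {t : Finset ι} {v : ι → EReal} (hv : ∀ i ∈ t, v i < ⊤) :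
    ∑ i ∈ t, v i < ⊤ :=
  Finset.sum_induction v (· < ⊤) (fun _ _ ha hb => EReal.add_lt_top ha.ne hb.ne)
    EReal.zero_lt_top hv

lemma coe_mul_lt_top {a : ℝ} (ha : 0 ≤ a) {y : EReal} (hy : y < ⊤) : (a : EReal) * y < ⊤ := by
  obtain ⟨c, hyc, -⟩ := EReal.lt_iff_exists_real_btwn.1 hy
  calc (a : EReal) * y ≤ a * c := mul_le_mul_of_nonneg_left hyc.le (EReal.coe_nonneg.2 ha)
    _ = ((a * c : ℝ) : EReal) := (EReal.coe_mul _ _).symm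
    _ < ⊤ := EReal.coe_lt_top _

lemma upperSemicontinuousOn_finsetSum {ι : Type*} {t : Finset ι} {f : ι → X → EReal}
    (hf : ∀ i ∈ t, UpperSemicontinuousOn (f i) s) (hf_top : ∀ i ∈ t, ∀ x ∈ s, f i x < ⊤) :
    UpperSemicontinuousOn (fun x => ∑ i ∈ t, f i x) s := by
  classical
  induction t using Finset.induction_on with
  | empty => simpa using upperSemicontinuousOn_const
  | insert j t hj ih =>
    simp only [Finset.forall_mem_insert] at hf hf_top
    simp only [Finset.sum_insert hj]
    exact hf.1.add' (ih hf.2 hf_top.2) fun x hx =>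
      EReal.continuousAt_add (.inl (hf_top.1 x hx).ne)
        (.inr (sum_lt_top fun i hi => hf_top.2 i hi x hx).ne)

end Semicontinuity

section FiniteProgram

variable {N K : ℕ}

/-- The average over `i` of the sums `∑ k, α i k * v i k`. It is the objective of the finite
program when `v i k` is the value of `ℓ k` at an atom, and an expectation under
`discreteDistribution α ξ` when `v i k` is the value of an integrand at `ξ i k`. -/
noncomputable def weightedMean (α : Fin N → Fin K → ℝ) (v : Fin N → Fin K → EReal) : EReal :=
  ((1 / (N : ℝ) : ℝ) : EReal) * ∑ i, ∑ k, ((α i k : ℝ) : EReal) * v i k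

lemma weightedMean_mono {α : Fin N → Fin K → ℝ} (hα : ∀ i k, 0 ≤ α i k)
    {v w : Fin N → Fin K → EReal} (hvw : ∀ i k, v i k ≤ w i k) :
    weightedMean α v ≤ weightedMean α w :=
  mul_le_mul_of_nonneg_left (Finset.sum_le_sum fun i _ => Finset.sum_le_sum fun k _ =>
    mul_le_mul_of_nonneg_left (hvw i k) (EReal.coe_nonneg.2 (hα i k)))
    (EReal.coe_nonneg.2 (by positivity))

lemma weightedMean_congr {α : Fin N → Fin K → ℝ} {v w : Fin N → Fin K → EReal}
    (hvw : ∀ i k, α i k ≠ 0 → v i k = w i k) : weightedMean α v = weightedMean α w := by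
  have hterm : ∀ i k, (α i k : EReal) * v i k = α i k * w i k := fun i k => by
    by_cases h0 : α i k = 0
    · simp [h0]
    · rw [hvw i k h0]
  simp only [weightedMean, hterm]

lemma upperSemicontinuousOn_weightedMean {X : Type*} [TopologicalSpace X]
    {ℓ : Fin K → X → EReal} (hℓ : ∀ k, UpperSemicontinuous (ℓ k)) (hℓ_top : ∀ k x, ℓ k x < ⊤) :
    UpperSemicontinuousOn
      (fun p : (Fin N → Fin K → ℝ) × (Fin N → Fin K → X) =>
        weightedMean p.1 fun i k => ℓ k (p.2 i k))
      {p | ∀ i k, 0 ≤ p.1 i k} := by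
  have hterm_top : ∀ i k, ∀ p ∈ {p : (Fin N → Fin K → ℝ) × (Fin N → Fin K → X) |
      ∀ i k, 0 ≤ p.1 i k}, (p.1 i k : EReal) * ℓ k (p.2 i k) < ⊤ := fun i k p hp =>
    coe_mul_lt_top (hp i k) (hℓ_top k _)
  refine upperSemicontinuousOn_coe_mul continuousOn_const (fun _ _ => by positivity)
    (upperSemicontinuousOn_finsetSum (fun i _ => upperSemicontinuousOn_finsetSum
      (fun k _ => upperSemicontinuousOn_coe_mul (by fun_prop) (fun p hp => hp i k) ?_
        fun p _ => hℓ_top k _) fun k _ => hterm_top i k)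
      fun i _ p hp => sum_lt_top fun k _ => hterm_top i k p hp)
    fun p hp => sum_lt_top fun i _ => sum_lt_top fun k _ => hterm_top i k p hp
  exact ((hℓ k).comp (by fun_prop)).upperSemicontinuousOn _

variable {E : Type*} [NormedAddCommGroup E] {Ξ : Set E} {data : Fin N → E} {ε : ℝ}
  {α : Fin N → Fin K → ℝ} {ξ q : Fin N → Fin K → E} {ℓ : Fin K → E → EReal}

/-- Feasibility in the finite program, in the variables `α i k` and `ξ i k` in which `q i k` is
`α i k • (data i - ξ i k)`. Unlike `Feasible`, it leaves the atoms of weight zero free in `Ξ`, which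
makes it a closed condition. -/
structure AtomFeasible (Ξ : Set E) (data : Fin N → E) (ε : ℝ) (α : Fin N → Fin K → ℝ)
    (ξ : Fin N → Fin K → E) : Prop where
  budget : (1 / (N : ℝ)) * ∑ i, ∑ k, α i k * ‖data i - ξ i k‖ ≤ ε
  sum_one : ∀ i, ∑ k, α i k = 1
  nonneg : ∀ i k, 0 ≤ α i k
  mem : ∀ i k, ξ i k ∈ Ξ

namespace AtomFeasible

lemma mono {ε' : ℝ} (h : AtomFeasible Ξ data ε α ξ) (hε : ε ≤ ε') :
    AtomFeasible Ξ data ε' α ξ :=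
  { h with budget := h.budget.trans hε }

lemma le_one (h : AtomFeasible Ξ data ε α ξ) (i : Fin N) (k : Fin K) : α i k ≤ 1 :=
  (Finset.single_le_sum (fun k _ => h.nonneg i k) (Finset.mem_univ k)).trans_eq (h.sum_one i)

lemma mul_norm_sub_le (h : AtomFeasible Ξ data ε α ξ) (i : Fin N) (k : Fin K) :
    α i k * ‖data i - ξ i k‖ ≤ N * ε := by
  have hterm : ∀ i k, 0 ≤ α i k * ‖data i - ξ i k‖ := fun i k =>
    mul_nonneg (h.nonneg i k) (norm_nonneg _)
  have hN : (0 : ℝ) < N := Nat.cast_pos.2 i.pos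
  calc α i k * ‖data i - ξ i k‖ ≤ ∑ k, α i k * ‖data i - ξ i k‖ :=
        Finset.single_le_sum (f := fun k => α i k * ‖data i - ξ i k‖) (fun k _ => hterm i k)
          (Finset.mem_univ k)
    _ ≤ ∑ i, ∑ k, α i k * ‖data i - ξ i k‖ :=
        Finset.single_le_sum (f := fun i => ∑ k, α i k * ‖data i - ξ i k‖)
          (fun i _ => Finset.sum_nonneg fun k _ => hterm i k) (Finset.mem_univ i)
    _ ≤ N * ε := by simpa only [one_div, inv_mul_le_iff₀ hN] using h.budget

end AtomFeasible

lemma exists_forall_norm_sub_le_of_atomFeasible (data : Fin N → E) (ε : ℝ)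
    (hΞ : Bornology.IsBounded Ξ ∨ K = 1) :
    ∃ R, ∀ (α : Fin N → Fin K → ℝ) (ξ : Fin N → Fin K → E), AtomFeasible Ξ data ε α ξ →
      ∀ i k, ‖data i - ξ i k‖ ≤ R := by
  rcases hΞ with hb | rfl
  · obtain ⟨R, hR⟩ := ((Set.finite_range data).isBounded.sub hb).exists_norm_le
    exact ⟨R, fun α ξ h i k => hR _ (Set.sub_mem_sub (Set.mem_range_self i) (h.mem i k))⟩
  · refine ⟨N * ε, fun α ξ h i k => ?_⟩
    have hα : α i k = 1 := by simpa [Subsingleton.elim k 0] using h.sum_one i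
    simpa [hα] using h.mul_norm_sub_le i k

lemma isClosed_setOf_atomFeasible (hΞ : IsClosed Ξ) (data : Fin N → E) (ε : ℝ) :
    IsClosed {p : (Fin N → Fin K → ℝ) × (Fin N → Fin K → E) |
      AtomFeasible Ξ data ε p.1 p.2} := by
  have hset : {p : (Fin N → Fin K → ℝ) × (Fin N → Fin K → E) | AtomFeasible Ξ data ε p.1 p.2} =
      {p | (1 / (N : ℝ)) * ∑ i, ∑ k, p.1 i k * ‖data i - p.2 i k‖ ≤ ε} ∩
        {p | ∀ i, ∑ k, p.1 i k = 1} ∩ {p | ∀ i k, 0 ≤ p.1 i k} ∩ {p | ∀ i k, p.2 i k ∈ Ξ} := by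
    ext p
    exact ⟨fun h => ⟨⟨⟨h.budget, h.sum_one⟩, h.nonneg⟩, h.mem⟩,
      fun h => ⟨h.1.1.1, h.1.1.2, h.1.2, h.2⟩⟩
  rw [hset]
  simp only [Set.ofPred_forall]
  refine (((isClosed_le (by fun_prop) continuous_const).inter (isClosed_iInter fun i =>
    isClosed_eq (by fun_prop) continuous_const)).inter (isClosed_iInter fun i =>
    isClosed_iInter fun k => isClosed_le continuous_const (by fun_prop))).inter
    (isClosed_iInter fun i => isClosed_iInter fun k => hΞ.preimage (by fun_prop))

lemma isClosed_of_properSpace [ProperSpace Ξ] : IsClosed Ξ :=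
  (completeSpace_coe_iff_isComplete.1 inferInstance).isClosed

lemma isCompact_inter_closedBall [ProperSpace Ξ] {y : E} (hy : y ∈ Ξ) (R : ℝ) :
    IsCompact (Ξ ∩ Metric.closedBall y R) := by
  have himage : Subtype.val '' Metric.closedBall (⟨y, hy⟩ : Ξ) R = Ξ ∩ Metric.closedBall y R := by
    ext z
    simp [and_comm]
  exact himage ▸ (isCompact_closedBall (⟨y, hy⟩ : Ξ) R).image continuous_subtype_val

lemma isCompact_setOf_atomFeasible [ProperSpace Ξ] (hdata : ∀ i, data i ∈ Ξ)
    (hΞ : Bornology.IsBounded Ξ ∨ K = 1) (ε : ℝ) :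
    IsCompact {p : (Fin N → Fin K → ℝ) × (Fin N → Fin K → E) |
      AtomFeasible Ξ data ε p.1 p.2} := by
  obtain ⟨R, hR⟩ := exists_forall_norm_sub_le_of_atomFeasible data ε hΞ
  have hbox : IsCompact
      ((Set.univ.pi fun _ : Fin N => Set.univ.pi fun _ : Fin K => Set.Icc (0 : ℝ) 1) ×ˢ
        (Set.univ.pi fun i : Fin N => Set.univ.pi fun _ : Fin K =>
          Ξ ∩ Metric.closedBall (data i) R)) :=
    (isCompact_univ_pi fun _ => isCompact_univ_pi fun _ => isCompact_Icc).prod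
      (isCompact_univ_pi fun i => isCompact_univ_pi fun _ =>
        isCompact_inter_closedBall (hdata i) R)
  refine hbox.of_isClosed_subset (isClosed_setOf_atomFeasible isClosed_of_properSpace data ε) ?_
  rintro ⟨α, ξ⟩ h
  exact ⟨fun i _ k _ => ⟨h.nonneg i k, h.le_one i k⟩, fun i _ k _ =>
    ⟨h.mem i k, mem_closedBall_iff_norm'.2 (hR α ξ h i k)⟩⟩

/-- The feasible pairs `(α, ξ)` of the finite program whose objective value is at least `v`. -/
def superlevelSet (Ξ : Set E) (data : Fin N → E) (ε : ℝ) (ℓ : Fin K → E → EReal) (v : EReal) :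
    Set ((Fin N → Fin K → ℝ) × (Fin N → Fin K → E)) :=
  {p | AtomFeasible Ξ data ε p.1 p.2} ∩
    (fun p => weightedMean p.1 fun i k => ℓ k (p.2 i k)) ⁻¹' Set.Ici v

lemma isCompact_superlevelSet [ProperSpace Ξ] (hdata : ∀ i, data i ∈ Ξ)
    (hΞ : Bornology.IsBounded Ξ ∨ K = 1) (ε : ℝ) (hℓ : ∀ k, UpperSemicontinuous (ℓ k))
    (hℓ_top : ∀ k x, ℓ k x < ⊤) (v : EReal) :
    IsCompact (superlevelSet Ξ data ε ℓ v) :=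
  ((upperSemicontinuousOn_weightedMean hℓ hℓ_top).mono
    fun _ h => AtomFeasible.nonneg h).isCompact_inter_preimage_Ici
    (isCompact_setOf_atomFeasible hdata hΞ ε) v

lemma nonempty_superlevelSet_of_forall_gt [ProperSpace Ξ] (hdata : ∀ i, data i ∈ Ξ)
    (hΞ : Bornology.IsBounded Ξ ∨ K = 1) (hℓ : ∀ k, UpperSemicontinuous (ℓ k))
    (hℓ_top : ∀ k x, ℓ k x < ⊤) {v : EReal}
    (hv : ∀ ε' > ε, (superlevelSet Ξ data ε' ℓ v).Nonempty) :
    (superlevelSet Ξ data ε ℓ v).Nonempty := by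
  have hcompact := fun ε' => isCompact_superlevelSet hdata hΞ ε' hℓ hℓ_top v
  obtain ⟨p, hp⟩ := IsCompact.nonempty_iInter_of_directed_nonempty_isCompact_isClosed
    (fun ε' : Set.Ioi ε => superlevelSet Ξ data ε' ℓ v)
    (directed_of_isDirected_ge fun _ _ h _ hp => ⟨hp.1.mono h, hp.2⟩)
    (fun ε' => hv ε' ε'.2) (fun ε' => hcompact ε') fun ε' => (hcompact ε').isClosed
  have hp' : ∀ ε' > ε, p ∈ superlevelSet Ξ data ε' ℓ v := fun ε' h => Set.mem_iInter.1 hp ⟨ε', h⟩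
  have hfeas : AtomFeasible Ξ data (ε + 1) p.1 p.2 := (hp' _ (lt_add_one ε)).1
  have hbudget := le_of_forall_gt_imp_ge_of_dense fun ε' h => (hp' ε' h).1.budget
  exact ⟨p, { hfeas with budget := hbudget }, (hp' _ (lt_add_one ε)).2⟩

lemma mem_superlevelSet_of_mapClusterPt [ProperSpace Ξ] (hdata : ∀ i, data i ∈ Ξ)
    (hΞ : Bornology.IsBounded Ξ ∨ K = 1) (hℓ : ∀ k, UpperSemicontinuous (ℓ k))
    (hℓ_top : ∀ k x, ℓ k x < ⊤) {ι : Type*} {F : Filter ι} {v : EReal}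
    {u : ι → (Fin N → Fin K → ℝ) × (Fin N → Fin K → E)}
    (hu : ∀ r, AtomFeasible Ξ data ε (u r).1 (u r).2)
    (hv : Tendsto (fun r => weightedMean (u r).1 fun i k => ℓ k ((u r).2 i k)) F (𝓝 v))
    {p : (Fin N → Fin K → ℝ) × (Fin N → Fin K → E)} (hp : MapClusterPt p F u) :
    p ∈ superlevelSet Ξ data ε ℓ v := by
  have hfeas : AtomFeasible Ξ data ε p.1 p.2 :=
    (isClosed_setOf_atomFeasible isClosed_of_properSpace data ε).mem_of_mapClusterPt hp
      (.of_forall hu)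
  have hvalue : v ≤ weightedMean p.1 fun i k => ℓ k (p.2 i k) :=
    le_of_forall_lt_imp_le_of_dense fun w hw =>
      ((isCompact_superlevelSet hdata hΞ ε hℓ hℓ_top w).isClosed.mem_of_mapClusterPt hp
        ((hv.eventually_const_le hw).mono fun r hr => ⟨hu r, hr⟩)).2
  exact ⟨hfeas, hvalue⟩

variable [NormedSpace ℝ E]

lemma objective_eq_weightedMean :
    objective data ℓ α q = weightedMean α fun i k => ℓ k (atoms data α q i k) :=
  rfl

lemma Feasible.smul_sub_atoms (h : Feasible Ξ data ε α q) (i : Fin N) (k : Fin K) :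
    α i k • (data i - atoms data α q i k) = q i k := by
  by_cases h0 : α i k = 0
  · simp [h0, h.zero i k h0]
  · simp [atoms, smul_inv_smul₀ h0]

lemma Feasible.atomFeasible (h : Feasible Ξ data ε α q) :
    AtomFeasible Ξ data ε α (atoms data α q) where
  budget := by
    have hnorm : ∀ i k, α i k * ‖data i - atoms data α q i k‖ = ‖q i k‖ := fun i k => by
      rw [← h.smul_sub_atoms i k, norm_smul, Real.norm_of_nonneg (h.nonneg i k)]
    simpa only [hnorm] using h.budget
  sum_one := h.sum_one
  nonneg := h.nonneg
  mem := h.mem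

lemma atoms_smul_sub (α : Fin N → Fin K → ℝ) (ξ : Fin N → Fin K → E) (i : Fin N) (k : Fin K) :
    atoms data α (fun i k => α i k • (data i - ξ i k)) i k =
      if α i k = 0 then data i else ξ i k := by
  by_cases h0 : α i k = 0
  · simp [atoms, h0]
  · simp [atoms, h0, inv_smul_smul₀ h0]

lemma AtomFeasible.feasible (h : AtomFeasible Ξ data ε α ξ) (hdata : ∀ i, data i ∈ Ξ) :
    Feasible Ξ data ε α (fun i k => α i k • (data i - ξ i k)) where
  budget := by
    simpa only [norm_smul, Real.norm_of_nonneg (h.nonneg _ _)] using h.budget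
  sum_one := h.sum_one
  nonneg := h.nonneg
  zero := fun i k h0 => by rw [h0, zero_smul]
  mem := fun i k => by
    rw [atoms_smul_sub]
    split_ifs
    exacts [hdata i, h.mem i k]

lemma AtomFeasible.weightedMean_le_optimalValue (h : AtomFeasible Ξ data ε α ξ)
    (hdata : ∀ i, data i ∈ Ξ) (ℓ : Fin K → E → EReal) :
    weightedMean α (fun i k => ℓ k (ξ i k)) ≤ optimalValue Ξ data ε ℓ := by
  refine le_sSup ⟨α, _, h.feasible hdata, ?_⟩
  rw [objective_eq_weightedMean]
  exact weightedMean_congr fun i k h0 => by rw [atoms_smul_sub, if_neg h0]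

lemma exists_feasible (hK : 0 < K) (hdata : ∀ i, data i ∈ Ξ) (hε : 0 ≤ ε) :
    ∃ (α : Fin N → Fin K → ℝ) (q : Fin N → Fin K → E), Feasible Ξ data ε α q := by
  refine ⟨fun _ => Pi.single ⟨0, hK⟩ 1, fun _ _ => 0, by simpa using hε, fun _ => by simp,
    fun _ k => ?_, by simp, fun i _ => by simpa [atoms] using hdata i⟩
  exact (Pi.single_nonneg (α := fun _ => ℝ)).2 zero_le_one k

lemma exists_isMaximizing (hK : 0 < K) (hdata : ∀ i, data i ∈ Ξ) (hε : 0 ≤ ε)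
    (ℓ : Fin K → E → EReal) : ∃ α q, IsMaximizing Ξ data ε ℓ α q := by
  obtain ⟨α₀, q₀, h₀⟩ := exists_feasible (N := N) hK hdata hε
  obtain ⟨u, -, hu, hmem⟩ := exists_seq_tendsto_sSup
    (S := {v | ∃ α q, Feasible Ξ data ε α q ∧ objective data ℓ α q = v})
    ⟨_, α₀, q₀, h₀, rfl⟩ (OrderTop.bddAbove _)
  choose α q hfeasible hvalue using hmem
  exact ⟨α, q, hfeasible, by simpa only [hvalue, optimalValue] using! hu⟩

lemma IsMaximizing.exists_mapClusterPt [ProperSpace Ξ] (hdata : ∀ i, data i ∈ Ξ)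
    (hΞ : Bornology.IsBounded Ξ ∨ K = 1) {α : ℕ → Fin N → Fin K → ℝ} {q : ℕ → Fin N → Fin K → E}
    (h : IsMaximizing Ξ data ε ℓ α q) :
    ∃ p : (Fin N → Fin K → ℝ) × (Fin N → Fin K → E),
      MapClusterPt p atTop fun r => (α r, atoms data (α r) (q r)) := by
  obtain ⟨p, -, hp⟩ := (isCompact_setOf_atomFeasible hdata hΞ ε).exists_mapClusterPt
    (f := atTop) (u := fun r => (α r, atoms data (α r) (q r)))
    (tendsto_principal.2 (.of_forall fun r => (h.1 r).atomFeasible))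
  exact ⟨p, hp⟩

lemma IsMaximizing.mem_superlevelSet [ProperSpace Ξ] (hdata : ∀ i, data i ∈ Ξ)
    (hΞ : Bornology.IsBounded Ξ ∨ K = 1) (hℓ : ∀ k, UpperSemicontinuous (ℓ k))
    (hℓ_top : ∀ k x, ℓ k x < ⊤) {α : ℕ → Fin N → Fin K → ℝ} {q : ℕ → Fin N → Fin K → E}
    (h : IsMaximizing Ξ data ε ℓ α q) {p : (Fin N → Fin K → ℝ) × (Fin N → Fin K → E)}
    (hp : MapClusterPt p atTop fun r => (α r, atoms data (α r) (q r))) :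
    p ∈ superlevelSet Ξ data ε ℓ (optimalValue Ξ data ε ℓ) :=
  mem_superlevelSet_of_mapClusterPt hdata hΞ hℓ hℓ_top
    (u := fun r => (α r, atoms data (α r) (q r))) (fun r => (h.1 r).atomFeasible) h.2 hp

end FiniteProgram

section ClosedConcave

variable {E : Type*} [NormedAddCommGroup E] [NormedSpace ℝ E] {f : E → EReal}

/-- A closed concave function without the value `∞`: it is upper semicontinuous and its hypograph
is convex. The constant function `-∞` is included. -/
structure IsClosedConcave (f : E → EReal) : Prop where
  lt_top : ∀ x, f x < ⊤
  convex_hypograph : Convex ℝ {p : E × ℝ | (p.2 : EReal) ≤ f p.1}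
  upperSemicontinuous : UpperSemicontinuous f

lemma ConvexityAssumption.isClosedConcave {Ξ : Set E} {K : ℕ} {ℓ : Fin K → E → EReal}
    (hℓ : ConvexityAssumption Ξ ℓ) (k : Fin K) : IsClosedConcave (ℓ k) where
  lt_top x := by simpa only [EReal.neg_bot] using EReal.lt_neg_comm.1 ((hℓ.proper k).2 x)
  convex_hypograph := by
    have hepigraph := (hℓ.convex k).linear_preimage (LinearMap.id.prodMap (-LinearMap.id))
    simpa [Set.preimage] using hepigraph
  upperSemicontinuous := by
    simpa only [Function.comp_def, neg_neg] using
      continuous_neg.comp_lowerSemicontinuous_antitone (hℓ.lsc k) EReal.neg_strictAnti.antitone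

namespace IsClosedConcave

lemma isClosed_hypograph (hf : IsClosedConcave f) :
    IsClosed {p : E × ℝ | (p.2 : EReal) ≤ f p.1} :=
  hf.upperSemicontinuous.IsClosed_hypograph.preimage
    (continuous_id.prodMap continuous_coe_real_ereal)

lemma exists_affine_majorant (hf : IsClosedConcave f) :
    ∃ (φ : E →L[ℝ] ℝ) (c : ℝ), ∀ x, f x ≤ ((φ x + c : ℝ) : EReal) := by
  by_cases hbot : ∀ x, f x = ⊥
  · exact ⟨0, 0, fun x => by simp [hbot x]⟩
  obtain ⟨x₀, hx₀⟩ := not_forall.1 hbot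
  obtain ⟨t₀, ht₀, -⟩ := EReal.lt_iff_exists_real_btwn.1 (hf.lt_top x₀)
  obtain ⟨ψ, u, hψ, hu⟩ := geometric_hahn_banach_closed_point hf.convex_hypograph
    hf.isClosed_hypograph (x := (x₀, t₀)) (not_le.2 ht₀)
  have hsplit : ∀ x t, ψ (x, t) = ψ (x, 0) + t * ψ (0, 1) := fun x t => by
    rw [← smul_eq_mul, ← map_smul, ← map_add]
    simp
  obtain ⟨s₀, hs₀⟩ : ∃ s₀ : ℝ, (s₀ : EReal) = f x₀ :=
    ⟨(f x₀).toReal, EReal.coe_toReal (hf.lt_top x₀).ne hx₀⟩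
  have hslope : 0 < ψ (0, 1) := by
    have hlt : ψ (x₀, s₀) < ψ (x₀, t₀) := (hψ _ hs₀.le).trans hu
    rw [hsplit x₀ s₀, hsplit x₀ t₀] at hlt
    have hst : s₀ < t₀ := EReal.coe_lt_coe_iff.1 (hs₀ ▸ ht₀)
    nlinarith
  refine ⟨-(ψ (0, 1))⁻¹ • ψ.comp (.inl ℝ E ℝ), (ψ (0, 1))⁻¹ * u, fun x => ?_⟩
  refine EReal.ge_of_forall_gt_iff_ge.1 fun t ht => EReal.coe_le_coe_iff.2 ?_
  have hlt : ψ (x, 0) + t * ψ (0, 1) < u := hsplit x t ▸ hψ (x, t) ht.le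
  calc t ≤ (ψ (0, 1))⁻¹ * (u - ψ (x, 0)) := by
        rw [le_inv_mul_iff₀ hslope]
        linarith
    _ = _ := by
        simp only [smul_apply, ContinuousLinearMap.comp_apply, ContinuousLinearMap.inl_apply,
          smul_eq_mul, neg_mul]
        ring

lemma measurable [MeasurableSpace E] [BorelSpace E] (hf : IsClosedConcave f) : Measurable f :=
  hf.upperSemicontinuous.measurable

lemma lintegral_toENNReal_ne_top [MeasurableSpace E] [BorelSpace E] {μ : Measure E}
    [IsFiniteMeasure μ] (hf : IsClosedConcave f) (hμ : Integrable (fun x => x) μ) :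
    ∫⁻ x, (f x).toENNReal ∂μ ≠ ⊤ := by
  obtain ⟨φ, c, hφ⟩ := hf.exists_affine_majorant
  have hmajorant : Integrable (fun x => φ x + c) μ :=
    (φ.integrable_comp hμ).add (integrable_const c)
  have hle : ∀ x, (f x).toENNReal ≤ ENNReal.ofReal (φ x + c) := fun x =>
    EReal.toENNReal_le_toENNReal (hφ x)
  exact ((lintegral_mono hle).trans_lt hmajorant.lintegral_lt_top).ne

end IsClosedConcave

end ClosedConcave

section Expectation

lemma coe_toENNReal_sub_coe_toENNReal_neg (y : EReal) :
    (y.toENNReal : EReal) - ((-y).toENNReal : EReal) = y := by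
  rcases le_total 0 y with hy | hy
  · rw [EReal.coe_toENNReal hy, EReal.toENNReal_of_nonpos (by simpa using hy)]
    simp
  · rw [EReal.toENNReal_of_nonpos hy, EReal.coe_toENNReal (by simpa using hy)]
    simp

lemma toReal_toENNReal_sub_toReal_toENNReal_neg (y : EReal) :
    y.toENNReal.toReal - (-y).toENNReal.toReal = y.toReal := by
  induction y with
  | bot => simp
  | coe y =>
    rw [← EReal.coe_neg, EReal.real_coe_toENNReal, EReal.real_coe_toENNReal,
      ENNReal.toReal_ofReal', ENNReal.toReal_ofReal', max_zero_sub_max_neg_zero_eq_self,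
      EReal.toReal_coe]
  | top => simp

variable {X : Type*} [MeasurableSpace X] {μ ν : Measure X} {f g : X → EReal}

lemma expectation_of_ne_top (hf : ∫⁻ x, (f x).toENNReal ∂μ ≠ ⊤) :
    expectation μ f = ((∫⁻ x, (f x).toENNReal ∂μ : ℝ≥0∞) : EReal) -
      ((∫⁻ x, (-f x).toENNReal ∂μ : ℝ≥0∞) : EReal) :=
  if_neg hf

lemma expectation_congr_ae (hfg : f =ᵐ[μ] g) : expectation μ f = expectation μ g := by
  have hpos : ∫⁻ x, (f x).toENNReal ∂μ = ∫⁻ x, (g x).toENNReal ∂μ :=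
    lintegral_congr_ae (hfg.mono fun x hx => by simp only [hx])
  have hneg : ∫⁻ x, (-f x).toENNReal ∂μ = ∫⁻ x, (-g x).toENNReal ∂μ :=
    lintegral_congr_ae (hfg.mono fun x hx => by simp only [hx])
  simp only [expectation, hpos, hneg]

lemma expectation_zero_measure : expectation (0 : Measure X) f = 0 := by
  simp [expectation]

lemma expectation_dirac [MeasurableSingletonClass X] (x : X) :
    expectation (Measure.dirac x) f = f x := by
  by_cases hx : f x = ⊤
  · simp [expectation, hx]
  · rw [expectation_of_ne_top (by simpa using hx), lintegral_dirac, lintegral_dirac,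
      coe_toENNReal_sub_coe_toENNReal_neg]

lemma expectation_smul_measure {c : ℝ≥0∞} (hc : c ≠ ⊤) (hf : ∫⁻ x, (f x).toENNReal ∂μ ≠ ⊤) :
    expectation (c • μ) f = c * expectation μ f := by
  have hcf : ∫⁻ x, (f x).toENNReal ∂(c • μ) ≠ ⊤ := by
    rw [lintegral_smul_measure]
    exact ENNReal.mul_ne_top hc hf
  rw [expectation_of_ne_top hf, expectation_of_ne_top hcf,
    EReal.mul_sub_of_nonneg_of_ne_top (EReal.coe_ennreal_nonneg c)
      (EReal.coe_ennreal_eq_top_iff.not.2 hc)]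
  simp only [lintegral_smul_measure, smul_eq_mul, EReal.coe_ennreal_mul]

lemma expectation_add_measure (hμ : ∫⁻ x, (f x).toENNReal ∂μ ≠ ⊤)
    (hν : ∫⁻ x, (f x).toENNReal ∂ν ≠ ⊤) :
    expectation (μ + ν) f = expectation μ f + expectation ν f := by
  have hμν : ∫⁻ x, (f x).toENNReal ∂(μ + ν) ≠ ⊤ := by
    rw [lintegral_add_measure]
    exact ENNReal.add_ne_top.2 ⟨hμ, hν⟩
  rw [expectation_of_ne_top hμν, expectation_of_ne_top hμ, expectation_of_ne_top hν,
    lintegral_add_measure, lintegral_add_measure, EReal.coe_ennreal_add, EReal.coe_ennreal_add]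
  simp only [sub_eq_add_neg]
  rw [EReal.neg_add (.inl (EReal.coe_ennreal_ne_bot _)) (.inr (EReal.coe_ennreal_ne_bot _)),
    sub_eq_add_neg, add_add_add_comm]

lemma expectation_finsetSum_measure {ι : Type*} (s : Finset ι) {μ : ι → Measure X}
    (hf : ∀ i ∈ s, ∫⁻ x, (f x).toENNReal ∂(μ i) ≠ ⊤) :
    expectation (∑ i ∈ s, μ i) f = ∑ i ∈ s, expectation (μ i) f := by
  classical
  induction s using Finset.induction_on with
  | empty => exact expectation_zero_measure
  | insert j s hj ih =>
    simp only [Finset.forall_mem_insert] at hf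
    rw [Finset.sum_insert hj, Finset.sum_insert hj, ← ih hf.2]
    refine expectation_add_measure hf.1 ?_
    rw [lintegral_finsetSum_measure]
    exact ENNReal.sum_ne_top.2 hf.2

lemma expectation_inv_smul_sum_measure {N K : ℕ} (hN : 0 < N) {μ : Fin N → Fin K → Measure X}
    (hf : ∀ i k, ∫⁻ x, (f x).toENNReal ∂(μ i k) ≠ ⊤) :
    expectation ((N : ℝ≥0∞)⁻¹ • ∑ i, ∑ k, μ i k) f =
      ((1 / (N : ℝ) : ℝ) : EReal) * ∑ i, ∑ k, expectation (μ i k) f := by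
  have hN_ne : (N : ℝ≥0∞)⁻¹ ≠ ⊤ := ENNReal.inv_ne_top.2 (Nat.cast_ne_zero.2 hN.ne')
  have hN_coe : (((N : ℝ≥0∞)⁻¹ : ℝ≥0∞) : EReal) = ((1 / (N : ℝ) : ℝ) : EReal) := by
    rw [← EReal.coe_ennreal_toReal hN_ne, ENNReal.toReal_inv, ENNReal.toReal_natCast, one_div]
  have hsum : ∀ i, ∫⁻ x, (f x).toENNReal ∂(∑ k, μ i k) ≠ ⊤ := fun i => by
    rw [lintegral_finsetSum_measure]
    exact ENNReal.sum_ne_top.2 fun k _ => hf i k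
  have hsum_sum : ∫⁻ x, (f x).toENNReal ∂(∑ i, ∑ k, μ i k) ≠ ⊤ := by
    rw [lintegral_finsetSum_measure]
    exact ENNReal.sum_ne_top.2 fun i _ => hsum i
  rw [expectation_smul_measure hN_ne hsum_sum, hN_coe,
    expectation_finsetSum_measure _ fun i _ => hsum i]
  simp only [expectation_finsetSum_measure _ fun k _ => hf _ k]

lemma integrable_toReal (hf : Measurable f) (hpos : ∫⁻ x, (f x).toENNReal ∂μ ≠ ⊤)
    (hneg : ∫⁻ x, (-f x).toENNReal ∂μ ≠ ⊤) : Integrable (fun x => (f x).toReal) μ := by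
  simp only [← toReal_toENNReal_sub_toReal_toENNReal_neg]
  exact (integrable_toReal_of_lintegral_ne_top hf.ereal_toENNReal.aemeasurable hpos).sub
    (integrable_toReal_of_lintegral_ne_top hf.neg.ereal_toENNReal.aemeasurable hneg)

lemma expectation_eq_integral_toReal (hf : Measurable f)
    (hpos : ∫⁻ x, (f x).toENNReal ∂μ ≠ ⊤) (hneg : ∫⁻ x, (-f x).toENNReal ∂μ ≠ ⊤) :
    expectation μ f = ((∫ x, (f x).toReal ∂μ : ℝ) : EReal) := by
  simp only [← toReal_toENNReal_sub_toReal_toENNReal_neg]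
  have hpos_meas : AEMeasurable (fun x => (f x).toENNReal) μ := hf.ereal_toENNReal.aemeasurable
  have hneg_meas : AEMeasurable (fun x => (-f x).toENNReal) μ :=
    hf.neg.ereal_toENNReal.aemeasurable
  rw [integral_sub (integrable_toReal_of_lintegral_ne_top hpos_meas hpos)
      (integrable_toReal_of_lintegral_ne_top hneg_meas hneg),
    integral_toReal hpos_meas (ae_lt_top' hpos_meas hpos),
    integral_toReal hneg_meas (ae_lt_top' hneg_meas hneg), EReal.coe_sub,
    EReal.coe_ennreal_toReal hpos, EReal.coe_ennreal_toReal hneg, expectation_of_ne_top hpos]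

end Expectation

section Jensen

variable {E : Type*} [NormedAddCommGroup E] [NormedSpace ℝ E] [CompleteSpace E]
  [MeasurableSpace E] {f : E → EReal} {μ : Measure E} [IsFiniteMeasure μ]

lemma ofReal_mul_norm_sub_average_le (hμ : Integrable (fun x => x) μ) (y : E) :
    ENNReal.ofReal (μ.real Set.univ * ‖y - ⨍ x, x ∂μ‖) ≤ ∫⁻ x, ‖y - x‖ₑ ∂μ := by
  have hintegral : ∫ x, (y - x) ∂μ = μ.real Set.univ • (y - ⨍ x, x ∂μ) := by
    rw [integral_sub (integrable_const y) hμ, integral_const, smul_sub, measure_smul_average]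
  rw [← Real.norm_of_nonneg (measureReal_nonneg (μ := μ) (s := Set.univ)), ← norm_smul,
    ← hintegral, ofReal_norm]
  exact enorm_integral_le_lintegral_enorm _

variable [BorelSpace E]

lemma IsClosedConcave.expectation_le_mul_average (hf : IsClosedConcave f)
    (hμ : Integrable (fun x => x) μ) :
    expectation μ f ≤ μ.real Set.univ * f (⨍ x, x ∂μ) := by
  rcases eq_zero_or_neZero μ with rfl | _
  · simp [expectation_zero_measure]
  have hpos := hf.lintegral_toENNReal_ne_top hμ
  by_cases hneg : ∫⁻ x, (-f x).toENNReal ∂μ = ⊤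
  · rw [expectation_of_ne_top hpos, hneg, EReal.coe_ennreal_top, EReal.sub_top]
    exact bot_le
  have hint := integrable_toReal hf.measurable hpos hneg
  have hle : ∀ᵐ x ∂μ, ((f x).toReal : EReal) ≤ f x := by
    filter_upwards [ae_lt_top hf.measurable.neg.ereal_toENNReal hneg] with x hx
    exact (EReal.coe_toReal (hf.lt_top x).ne fun hbot => by simp [hbot] at hx).le
  have hmem := hf.convex_hypograph.average_mem hf.isClosed_hypograph hle (hμ.prodMk hint)
  rw [average_pair hμ hint] at hmem
  rw [expectation_eq_integral_toReal hf.measurable hpos hneg, ← measure_smul_average, smul_eq_mul,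
    EReal.coe_mul]
  exact mul_le_mul_of_nonneg_left hmem (EReal.coe_nonneg.2 measureReal_nonneg)

lemma exists_barycenter {Ξ : Set E} (hΞ : Convex ℝ Ξ) (hΞ_closed : IsClosed Ξ)
    (hΞ_nonempty : Ξ.Nonempty) (hμΞ : ∀ᵐ x ∂μ, x ∈ Ξ) (hμ : Integrable (fun x => x) μ) :
    ∃ z ∈ Ξ, (∀ y, ENNReal.ofReal (μ.real Set.univ * ‖y - z‖) ≤ ∫⁻ x, ‖y - x‖ₑ ∂μ) ∧
      ∀ f, IsClosedConcave f → expectation μ f ≤ μ.real Set.univ * f z := by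
  rcases eq_zero_or_neZero μ with rfl | _
  · obtain ⟨z, hz⟩ := hΞ_nonempty
    exact ⟨z, hz, by simp, by simp [expectation_zero_measure]⟩
  · exact ⟨⨍ x, x ∂μ, hΞ.average_mem hΞ_closed hμΞ hμ, ofReal_mul_norm_sub_average_le hμ,
      fun f hf => hf.expectation_le_mul_average hμ⟩

end Jensen

section DiscreteDistribution

variable {N K : ℕ}

lemma ofReal_one_div_mul_sum (hN : 0 < N) {a : Fin N → Fin K → ℝ} (ha : ∀ i k, 0 ≤ a i k) :
    ENNReal.ofReal ((1 / (N : ℝ)) * ∑ i, ∑ k, a i k) =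
      (N : ℝ≥0∞)⁻¹ * ∑ i, ∑ k, ENNReal.ofReal (a i k) := by
  rw [ENNReal.ofReal_mul (by positivity), one_div, ENNReal.ofReal_inv_of_pos (Nat.cast_pos.2 hN),
    ENNReal.ofReal_natCast, ENNReal.ofReal_sum_of_nonneg fun i _ =>
      Finset.sum_nonneg fun k _ => ha i k]
  simp only [ENNReal.ofReal_sum_of_nonneg fun k _ => ha _ k]

section MeasurableSpace

variable {X Y : Type*} [MeasurableSpace X] [MeasurableSpace Y] {α : Fin N → Fin K → ℝ}
  {ξ : Fin N → Fin K → X}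

lemma lintegral_discreteDistribution [MeasurableSingletonClass X] (f : X → ℝ≥0∞) :
    ∫⁻ x, f x ∂(discreteDistribution α ξ) =
      (N : ℝ≥0∞)⁻¹ * ∑ i, ∑ k, ENNReal.ofReal (α i k) * f (ξ i k) := by
  simp [discreteDistribution, lintegral_finsetSum_measure]

lemma map_discreteDistribution {g : X → Y} (hg : Measurable g) :
    (discreteDistribution α ξ).map g = discreteDistribution α fun i k => g (ξ i k) := by
  simp only [discreteDistribution, Measure.map_smul, Measure.map_finset_sum hg.aemeasurable,
    Measure.map_dirac' hg]

lemma discreteDistribution_eq_empirical (hα : ∀ i k, 0 ≤ α i k) (hsum : ∀ i, ∑ k, α i k = 1)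
    (data : Fin N → X) : (discreteDistribution α fun i _ => data i) = empirical data := by
  have hweight : ∀ i, ∑ k, ENNReal.ofReal (α i k) = 1 := fun i => by
    rw [← ENNReal.ofReal_sum_of_nonneg fun k _ => hα i k, hsum i, ENNReal.ofReal_one]
  simp only [discreteDistribution, empirical, ← Finset.sum_smul, hweight, one_smul]

lemma expectation_discreteDistribution [MeasurableSingletonClass X] (hN : 0 < N)
    (hα : ∀ i k, 0 ≤ α i k) {f : X → EReal} (hf : ∀ i k, f (ξ i k) < ⊤) :
    expectation (discreteDistribution α ξ) f = weightedMean α fun i k => f (ξ i k) := by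
  have hdirac : ∀ i k, ∫⁻ x, (f x).toENNReal ∂(Measure.dirac (ξ i k)) ≠ ⊤ := fun i k => by
    rw [lintegral_dirac]
    exact EReal.toENNReal_ne_top_iff.2 (hf i k).ne
  have hterm : ∀ i k, expectation (ENNReal.ofReal (α i k) • Measure.dirac (ξ i k)) f =
      α i k * f (ξ i k) := fun i k => by
    rw [expectation_smul_measure ENNReal.ofReal_ne_top (hdirac i k), expectation_dirac,
      EReal.coe_ennreal_ofReal, max_eq_left (hα i k)]
  rw [discreteDistribution, expectation_inv_smul_sum_measure hN fun i k => ?_]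
  · simp only [hterm, weightedMean]
  · rw [lintegral_smul_measure]
    exact ENNReal.mul_ne_top ENNReal.ofReal_ne_top (hdirac i k)

end MeasurableSpace

section Loss

variable {X : Type*} {ℓ : Fin K → X → EReal}

lemma le_loss (k : Fin K) (x : X) : ℓ k x ≤ loss ℓ x :=
  le_iSup (fun k => ℓ k x) k

lemma loss_lt_top {x : X} (hℓ : ∀ k, ℓ k x < ⊤) : loss ℓ x < ⊤ := by
  rw [loss, ← Finset.sup_univ_eq_iSup]
  exact (Finset.sup_lt_iff bot_lt_top).2 fun k _ => hℓ k

lemma exists_eq_loss (hK : 0 < K) (ℓ : Fin K → X → EReal) (x : X) : ∃ k, ℓ k x = loss ℓ x :=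
  have : Nonempty (Fin K) := ⟨⟨0, hK⟩⟩
  exists_eq_ciSup_of_finite

end Loss

namespace AtomFeasible

variable {E : Type*} [NormedAddCommGroup E] [MeasurableSpace E] {Ξ : Set E}
  {data : Fin N → E} {ε : ℝ} {α : Fin N → Fin K → ℝ} {ξ : Fin N → Fin K → E}
  {ℓ : Fin K → E → EReal}

lemma weightedMean_le_expectation [MeasurableSingletonClass E] (h : AtomFeasible Ξ data ε α ξ)
    (hN : 0 < N) (hℓ : ∀ k x, ℓ k x < ⊤) :
    weightedMean α (fun i k => ℓ k (ξ i k)) ≤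
      expectation (discreteDistribution α ξ) (loss ℓ) := by
  rw [expectation_discreteDistribution hN h.nonneg fun i k => loss_lt_top fun j => hℓ j _]
  exact weightedMean_mono h.nonneg fun i k => le_loss k _

lemma mem_distributions [OpensMeasurableSpace E] (h : AtomFeasible Ξ data ε α ξ)
    (hN : 0 < N) (hΞ : IsClosed Ξ) : discreteDistribution α ξ ∈ distributions Ξ := by
  have hN' : (N : ℝ) ≠ 0 := Nat.cast_ne_zero.2 hN.ne'
  refine ⟨⟨?_⟩, ?_, ?_⟩
  · rw [← lintegral_one, lintegral_discreteDistribution]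
    simp only [mul_one]
    rw [← ofReal_one_div_mul_sum hN h.nonneg]
    simp [h.sum_one, hN']
  · rw [← lintegral_indicator_one hΞ.measurableSet.compl, lintegral_discreteDistribution]
    simp [h.mem]
  · rw [lintegral_discreteDistribution]
    exact ENNReal.mul_lt_top (ENNReal.inv_ne_top.2 (Nat.cast_ne_zero.2 hN.ne')).lt_top
      (ENNReal.sum_lt_top.2 fun i _ => ENNReal.sum_lt_top.2 fun k _ =>
        ENNReal.mul_lt_top ENNReal.ofReal_lt_top enorm_lt_top)

lemma wasserstein_le [MeasurableSingletonClass E] (h : AtomFeasible Ξ data ε α ξ) (hN : 0 < N) :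
    wasserstein (empirical data) (discreteDistribution α ξ) ≤ ENNReal.ofReal ε := by
  have hcoupling : discreteDistribution α (fun i k => (data i, ξ i k)) ∈
      couplings (empirical data) (discreteDistribution α ξ) :=
    ⟨(map_discreteDistribution measurable_fst).trans
      (discreteDistribution_eq_empirical h.nonneg h.sum_one data),
      map_discreteDistribution measurable_snd⟩
  calc wasserstein (empirical data) (discreteDistribution α ξ)
      ≤ ∫⁻ z, ‖z.1 - z.2‖ₑ ∂(discreteDistribution α fun i k => (data i, ξ i k)) :=
        iInf₂_le _ hcoupling
    _ = (N : ℝ≥0∞)⁻¹ * ∑ i, ∑ k, ENNReal.ofReal (α i k * ‖data i - ξ i k‖) := by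
        rw [lintegral_discreteDistribution]
        simp only [ENNReal.ofReal_mul (h.nonneg _ _), ofReal_norm]
    _ = ENNReal.ofReal ((1 / (N : ℝ)) * ∑ i, ∑ k, α i k * ‖data i - ξ i k‖) :=
        (ofReal_one_div_mul_sum hN fun i k => mul_nonneg (h.nonneg i k) (norm_nonneg _)).symm
    _ ≤ ENNReal.ofReal ε := ENNReal.ofReal_le_ofReal h.budget

lemma mem_ball [OpensMeasurableSpace E] (h : AtomFeasible Ξ data ε α ξ) (hN : 0 < N)
    (hΞ : IsClosed Ξ) : discreteDistribution α ξ ∈ ball Ξ data ε :=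
  ⟨h.mem_distributions hN hΞ, h.wasserstein_le hN⟩

end AtomFeasible

end DiscreteDistribution

section TransportPlan

variable {N K : ℕ}

lemma exists_eq_inv_smul_sum_map_prodMk {X Y : Type*} [MeasurableSpace X]
    [MeasurableSingletonClass X] [MeasurableSpace Y] [StandardBorelSpace Y] [Nonempty Y]
    {data : Fin N → X} {P : Measure (X × Y)} [IsFiniteMeasure P]
    (hP : P.map Prod.fst = empirical data) :
    ∃ ν : Fin N → Measure Y, (∀ i, IsProbabilityMeasure (ν i)) ∧
      P = (N : ℝ≥0∞)⁻¹ • ∑ i, (ν i).map (Prod.mk (data i)) := by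
  refine ⟨fun i => P.condKernel (data i), fun i => inferInstance,
    Measure.ext_of_lintegral _ fun F hF => ?_⟩
  conv_lhs => rw [← P.disintegrate P.condKernel]
  rw [Measure.lintegral_compProd hF, Measure.fst, hP]
  simp [empirical, lintegral_finsetSum_measure, lintegral_map hF measurable_prodMk_left]

lemma exists_measurable_partition_loss {X : Type*} [MeasurableSpace X] (hK : 0 < K)
    {ℓ : Fin K → X → EReal} (hℓ : ∀ k, Measurable (ℓ k)) :
    ∃ A : Fin K → Set X, (∀ k, MeasurableSet (A k)) ∧ Pairwise (Function.onFun Disjoint A) ∧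
      ⋃ k, A k = Set.univ ∧ ∀ k, ∀ x ∈ A k, loss ℓ x = ℓ k x := by
  let B : Fin K → Set X := fun k => {x | loss ℓ x = ℓ k x}
  have hB : ∀ k, MeasurableSet (B k) := fun k => measurableSet_eq_fun (.iSup hℓ) (hℓ k)
  refine ⟨disjointed B, fun k => disjointedRec (fun _ _ h => h.diff (hB _)) (hB k),
    disjoint_disjointed B, ?_, fun k x hx => disjointed_subset B k hx⟩
  rw [iUnion_disjointed, Set.eq_univ_iff_forall]
  exact fun x => Set.mem_iUnion.2 ((exists_eq_loss hK ℓ x).imp fun _ => Eq.symm)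

lemma sum_restrict_of_partition {X ι : Type*} [MeasurableSpace X] [Fintype ι] (ν : Measure X)
    {A : ι → Set X} (hA : ∀ k, MeasurableSet (A k)) (hdisj : Pairwise (Function.onFun Disjoint A))
    (hcover : ⋃ k, A k = Set.univ) : ∑ k, ν.restrict (A k) = ν := by
  rw [← Measure.sum_fintype, ← Measure.restrict_iUnion hdisj hA, hcover, Measure.restrict_univ]

variable {E : Type*} [NormedAddCommGroup E] [MeasurableSpace E] {Ξ : Set E} {data : Fin N → E}
  {ε ε' : ℝ} {ℓ : Fin K → E → EReal} {Q : Measure E} {μ : Fin N → Fin K → Measure E}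

/-- A transport plan of cost at most `ε` from the empirical distribution to `Q`, split according to
the concave piece that attains the loss: `μ i k` is the mass, normalized by `N`, that is sent from
`data i` to points at which `loss ℓ` equals `ℓ k`. -/
structure IsTransportPlan (data : Fin N → E) (ε : ℝ) (ℓ : Fin K → E → EReal) (Q : Measure E)
    (μ : Fin N → Fin K → Measure E) : Prop where
  eq_inv_smul_sum : Q = (N : ℝ≥0∞)⁻¹ • ∑ i, ∑ k, μ i k
  isProbabilityMeasure_sum : ∀ i, IsProbabilityMeasure (∑ k, μ i k)
  loss_eq : ∀ i k, loss ℓ =ᵐ[μ i k] ℓ k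
  cost_le : (N : ℝ≥0∞)⁻¹ * ∑ i, ∑ k, ∫⁻ x, ‖data i - x‖ₑ ∂(μ i k) ≤ ENNReal.ofReal ε

lemma exists_isTransportPlan [CompleteSpace E] [SecondCountableTopology E] [BorelSpace E]
    (hK : 0 < K) (hℓ : ∀ k, Measurable (ℓ k)) [IsFiniteMeasure Q] (hε' : 0 < ε')
    (hQ : wasserstein (empirical data) Q ≤ ENNReal.ofReal ε) (hε : ε < ε') :
    ∃ μ, IsTransportPlan data ε' ℓ Q μ := by
  have hlt : wasserstein (empirical data) Q < ENNReal.ofReal ε' :=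
    hQ.trans_lt ((ENNReal.ofReal_lt_ofReal_iff hε').2 hε)
  simp only [wasserstein, iInf_lt_iff] at hlt
  obtain ⟨P, ⟨hfst, hsnd⟩, hcost⟩ := hlt
  have : IsFiniteMeasure P := ⟨by
    rw [← Set.preimage_univ (f := Prod.snd), ← Measure.map_apply measurable_snd .univ, hsnd]
    exact measure_lt_top Q _⟩
  obtain ⟨ν, hν, rfl⟩ := exists_eq_inv_smul_sum_map_prodMk hfst
  obtain ⟨A, hA, hdisj, hcover, hAℓ⟩ := exists_measurable_partition_loss hK hℓ
  have hsum : ∀ i, ∑ k, (ν i).restrict (A k) = ν i := fun i =>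
    sum_restrict_of_partition (ν i) hA hdisj hcover
  refine ⟨fun i k => (ν i).restrict (A k), ?_, fun i => (hsum i).symm ▸ hν i, fun i k =>
    (ae_restrict_mem (hA k)).mono fun x hx => hAℓ k x hx, ?_⟩
  · rw [← hsnd, Measure.map_smul, Measure.map_finset_sum measurable_snd.aemeasurable]
    simp [hsum, Measure.map_map measurable_snd measurable_prodMk_left, Function.comp_def]
  · have hmeas : Measurable fun z : E × E => ‖z.1 - z.2‖ₑ :=
      (measurable_fst.sub measurable_snd).enorm
    simp only [← lintegral_finsetSum_measure, hsum]
    simpa [lintegral_finsetSum_measure, lintegral_map hmeas measurable_prodMk_left] using hcost.le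

namespace IsTransportPlan

variable (h : IsTransportPlan data ε ℓ Q μ)
include h

lemma le_smul (i : Fin N) (k : Fin K) : μ i k ≤ (N : ℝ≥0∞) • Q := by
  have hN : (N : ℝ≥0∞) ≠ 0 := Nat.cast_ne_zero.2 i.pos.ne'
  have hle : ∀ s, μ i k s ≤ ∑ i, ∑ k, μ i k s := fun s =>
    (Finset.single_le_sum (f := fun k => μ i k s) (fun _ _ => zero_le) (Finset.mem_univ k)).trans
      (Finset.single_le_sum (f := fun i => ∑ k, μ i k s) (fun _ _ => zero_le) (Finset.mem_univ i))
  rw [h.eq_inv_smul_sum, smul_smul, ENNReal.mul_inv_cancel hN (ENNReal.natCast_ne_top N), one_smul]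
  exact Measure.le_iff'.2 fun s => by simpa using hle s

lemma integrable {F : Type*} [NormedAddCommGroup F] {f : E → F} (hf : Integrable f Q) (i : Fin N)
    (k : Fin K) : Integrable f (μ i k) :=
  hf.of_measure_le_smul (ENNReal.natCast_ne_top N) (h.le_smul i k)

lemma absolutelyContinuous (i : Fin N) (k : Fin K) : μ i k ≪ Q :=
  Measure.absolutelyContinuous_of_le_smul (h.le_smul i k)

lemma isFiniteMeasure [IsFiniteMeasure Q] (i : Fin N) (k : Fin K) : IsFiniteMeasure (μ i k) :=
  have : IsFiniteMeasure ((N : ℝ≥0∞) • Q) := Q.smul_finite (ENNReal.natCast_ne_top N)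
  isFiniteMeasure_of_le _ (h.le_smul i k)

lemma exists_mem_superlevelSet [NormedSpace ℝ E] [CompleteSpace E] [BorelSpace E]
    [IsFiniteMeasure Q] (hN : 0 < N) (hΞ : Convex ℝ Ξ) (hΞ_closed : IsClosed Ξ)
    (hΞ_nonempty : Ξ.Nonempty) (hQ : ∀ᵐ x ∂Q, x ∈ Ξ) (hQ_int : Integrable (fun x => x) Q)
    (hε : 0 ≤ ε) (hℓ : ∀ k, IsClosedConcave (ℓ k)) :
    ∃ ξ, ((fun i k => (μ i k).real Set.univ), ξ) ∈
      superlevelSet Ξ data ε ℓ (expectation Q (loss ℓ)) := by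
  have := h.isFiniteMeasure
  choose ξ hξ hcost hJensen using fun i k => exists_barycenter hΞ hΞ_closed hΞ_nonempty
    (h.absolutelyContinuous i k hQ) (h.integrable hQ_int i k)
  have hfeas : AtomFeasible Ξ data ε (fun i k => (μ i k).real Set.univ) ξ :=
    { budget := by
        rw [← ENNReal.ofReal_le_ofReal_iff hε, ofReal_one_div_mul_sum hN fun i k => by positivity]
        refine le_trans ?_ h.cost_le
        gcongr with i _ k _
        exact hcost i k (data i)
      sum_one := fun i => by
        have := h.isProbabilityMeasure_sum i
        simp only [← probReal_univ (μ := ∑ k, μ i k), Measure.real, Measure.coe_finsetSum,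
          Finset.sum_apply, ENNReal.toReal_sum fun k _ => measure_ne_top (μ i k) Set.univ]
      nonneg := fun i k => measureReal_nonneg
      mem := hξ }
  have hvalue : ∀ i k, expectation (μ i k) (loss ℓ) ≤ (μ i k).real Set.univ * ℓ k (ξ i k) :=
    fun i k => (expectation_congr_ae (h.loss_eq i k)).trans_le (hJensen i k (ℓ k) (hℓ k))
  have hpos : ∀ i k, ∫⁻ x, (loss ℓ x).toENNReal ∂(μ i k) ≠ ⊤ := fun i k => by
    refine (lintegral_congr_ae ((h.loss_eq i k).fun_comp EReal.toENNReal)).trans_ne ?_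
    exact (hℓ k).lintegral_toENNReal_ne_top (h.integrable hQ_int i k)
  refine ⟨ξ, hfeas, ?_⟩
  rw [Set.mem_preimage, Set.mem_Ici, h.eq_inv_smul_sum, expectation_inv_smul_sum_measure hN hpos]
  exact mul_le_mul_of_nonneg_left (Finset.sum_le_sum fun i _ => Finset.sum_le_sum fun k _ =>
    hvalue i k) (EReal.coe_nonneg.2 (by positivity))

end IsTransportPlan

variable [NormedSpace ℝ E] [CompleteSpace E] [SecondCountableTopology E] [BorelSpace E]

lemma expectation_le_optimalValue [ProperSpace Ξ] (hN : 0 < N) (hK : 0 < K)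
    (hΞ_convex : Convex ℝ Ξ) (hdata : ∀ i, data i ∈ Ξ) (hε : 0 ≤ ε)
    (hℓ : ∀ k, IsClosedConcave (ℓ k)) (hΞ : Bornology.IsBounded Ξ ∨ K = 1)
    (hQ : Q ∈ ball Ξ data ε) : expectation Q (loss ℓ) ≤ optimalValue Ξ data ε ℓ := by
  obtain ⟨⟨hprob, hsupp, hmoment⟩, hdist⟩ := hQ
  have hint : Integrable (fun x => x) Q := ⟨by fun_prop, hmoment⟩
  have hrelaxed : ∀ ε' > ε, (superlevelSet Ξ data ε' ℓ (expectation Q (loss ℓ))).Nonempty := by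
    intro ε' hε'
    have hpos : 0 < ε' := hε.trans_lt hε'
    obtain ⟨μ, hμ⟩ := exists_isTransportPlan hK (fun k => (hℓ k).measurable) hpos hdist hε'
    obtain ⟨ξ, hξ⟩ := hμ.exists_mem_superlevelSet hN hΞ_convex isClosed_of_properSpace
      ⟨data ⟨0, hN⟩, hdata _⟩ hsupp hint hpos.le hℓ
    exact ⟨_, hξ⟩
  obtain ⟨p, hfeas, hvalue⟩ := nonempty_superlevelSet_of_forall_gt hdata hΞ
    (fun k => (hℓ k).upperSemicontinuous) (fun k => (hℓ k).lt_top) hrelaxed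
  exact hvalue.trans (hfeas.weightedMean_le_optimalValue hdata ℓ)

lemma worstCaseExpectation_le_optimalValue [ProperSpace Ξ] (hN : 0 < N) (hK : 0 < K)
    (hΞ_convex : Convex ℝ Ξ) (hdata : ∀ i, data i ∈ Ξ) (hε : 0 ≤ ε)
    (hℓ : ∀ k, IsClosedConcave (ℓ k)) (hΞ : Bornology.IsBounded Ξ ∨ K = 1) :
    worstCaseExpectation Ξ data ε ℓ ≤ optimalValue Ξ data ε ℓ :=
  iSup₂_le fun _ hQ => expectation_le_optimalValue hN hK hΞ_convex hdata hε hℓ hΞ hQ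

end TransportPlan

end WassersteinDRO

open WassersteinDRO Filter in
theorem mainTheorem12_general {E : Type*} [NormedAddCommGroup E] [NormedSpace ℝ E]
    [CompleteSpace E] [SecondCountableTopology E] [MeasurableSpace E] [BorelSpace E]
    {N K : ℕ} (hN : 0 < N) (hK : 0 < K)
    (Ξ : Set E) [ProperSpace Ξ] (hΞ_convex : Convex ℝ Ξ)
    (data : Fin N → E) (hdata : ∀ i, data i ∈ Ξ)
    (ε : ℝ) (hε : 0 ≤ ε) (ℓ : Fin K → E → EReal)
    (hℓ : ∀ k, IsClosedConcave (ℓ k))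
    (hΞ : Bornology.IsBounded Ξ ∨ K = 1) :
    (∃ α q, IsMaximizing Ξ data ε ℓ α q) ∧
    ∀ (α : ℕ → Fin N → Fin K → ℝ) (q : ℕ → Fin N → Fin K → E),
      IsMaximizing Ξ data ε ℓ α q →
      (∃ p : (Fin N → Fin K → ℝ) × (Fin N → Fin K → E),
        MapClusterPt p atTop fun r => (α r, atoms data (α r) (q r))) ∧
      ∀ (αs : Fin N → Fin K → ℝ) (ξs : Fin N → Fin K → E),
        MapClusterPt (αs, ξs) atTop (fun r => (α r, atoms data (α r) (q r))) →
        discreteDistribution αs ξs ∈ ball Ξ data ε ∧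
        expectation (discreteDistribution αs ξs) (loss ℓ) = worstCaseExpectation Ξ data ε ℓ := by
  refine ⟨exists_isMaximizing hK hdata hε ℓ, fun α q hmax =>
    ⟨hmax.exists_mapClusterPt hdata hΞ, fun αs ξs hcluster => ?_⟩⟩
  have hℓ_top : ∀ k x, ℓ k x < ⊤ := fun k => (hℓ k).lt_top
  obtain ⟨hfeas, hvalue⟩ := hmax.mem_superlevelSet hdata hΞ
    (fun k => (hℓ k).upperSemicontinuous) hℓ_top hcluster
  have hball := hfeas.mem_ball hN isClosed_of_properSpace
  refine ⟨hball, le_antisymm (le_iSup₂_of_le _ hball le_rfl) ?_⟩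
  calc worstCaseExpectation Ξ data ε ℓ
      ≤ optimalValue Ξ data ε ℓ :=
        worstCaseExpectation_le_optimalValue hN hK hΞ_convex hdata hε hℓ hΞ
    _ ≤ weightedMean αs fun i k => ℓ k (ξs i k) := hvalue
    _ ≤ expectation (discreteDistribution αs ξs) (loss ℓ) :=
        hfeas.weightedMean_le_expectation hN hℓ_top

theorem mainTheorem12 {E : Type*} [NormedAddCommGroup E] [NormedSpace ℝ E]
    [FiniteDimensional ℝ E] [MeasurableSpace E] [BorelSpace E]
    {N K : ℕ} (hN : 0 < N) (hK : 0 < K)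
    (Ξ : Set E) (data : Fin N → E) (hdata : ∀ i, data i ∈ Ξ)
    (ε : ℝ) (hε : 0 ≤ ε) (ℓ : Fin K → E → EReal)
    (hℓ : WassersteinDRO.ConvexityAssumption Ξ ℓ)
    (hcase : IsCompact Ξ ∨ K = 1) :
    (∃ α q, WassersteinDRO.IsMaximizing Ξ data ε ℓ α q) ∧
    ∀ (α : ℕ → Fin N → Fin K → ℝ) (q : ℕ → Fin N → Fin K → E),
      WassersteinDRO.IsMaximizing Ξ data ε ℓ α q →
      (∃ p : (Fin N → Fin K → ℝ) × (Fin N → Fin K → E),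
        MapClusterPt p Filter.atTop
          (fun r => (α r, WassersteinDRO.atoms data (α r) (q r)))) ∧
      ∀ (αs : Fin N → Fin K → ℝ) (ξs : Fin N → Fin K → E),
        MapClusterPt (αs, ξs) Filter.atTop
          (fun r => (α r, WassersteinDRO.atoms data (α r) (q r))) →
        WassersteinDRO.discreteDistribution αs ξs ∈ WassersteinDRO.ball Ξ data ε ∧
        WassersteinDRO.expectation (WassersteinDRO.discreteDistribution αs ξs)
            (WassersteinDRO.loss ℓ) =
          WassersteinDRO.worstCaseExpectation Ξ data ε ℓ := by
  have := FiniteDimensional.complete ℝ E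
  have := FiniteDimensional.proper ℝ E
  have := ProperSpace.of_isClosed hℓ.closed_set
  exact mainTheorem12_general hN hK Ξ hℓ.convex_set data hdata ε hε ℓ hℓ.isClosedConcave
    (hcase.imp_left IsCompact.isBounded)
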